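/- Let $\mathcal{G}(V\cup U)$ be a causal DAG with finitely many observed vertices $V$ and latent vertices $U$. Consider a structural causal model over it: real-valued variables $V_i \leftarrow f_i(\mathrm{pa}_{\mathcal G}(V_i),\epsilon_i)$ with measurable $f_i$ and mutually independent errors $\epsilon_i$. Let $P$ be the induced law of the observed variables; $\mathrm{do}(A=a)$ replaces the equation of $A$ by the constant $a$. Let $Z, A, Y\in V$ and $C\subseteq V$ with $Z\notin C$, and assume: 1. $P$ is faithful to $\mathcal{G}$: for all pairwise disjoint $X_1,X_2,S\subseteq V$, $X_1$ and $X_2$ are d-separated by $S$ in $\mathcal{G}$ if and only if $X_1 \perp\!\!\!\perp X_2\mid S$ in $P$. 2. $\mathcal{G}$ has a topological ordering in which $Z$ and all elements of $C$ precede $A$, and $A$ precedes $Y$. 3. The path $Z\to A\to Y$ exists in $\mathcal{G}$. Let $W\subseteq C$ be a proposed adjustment set. Assume that $\theta = \mathbb{E}[Y\mid \mathrm{do}(A=1)]-\mathbb{E}[Y\mid \mathrm{do}(A=0)]$ is well defined ($Y$ is integrable under $\mathrm{do}(A=0)$ and $\mathrm{do}(A=1)$) and that positivity holds: for $a\in\{0,1\}$,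 every event about $W$ that has positive probability has positive probability jointly with $A=a$. Let $\beta$ be any real parameter of the observed law such that $\beta(P)=0$ if and only if $Y\perp\!\!\!\perp Z\mid A, W$ in $P$. If $\beta(P)=0$, then $W$ is a valid backdoor adjustment set (no element of $W$ is a descendant of $A$, and $W$ blocks every path between $A$ and $Y$ that starts with an arrow into $A$), the expectations in the backdoor formula exist, and the backdoor formula equals the causal effect: $$\mathbb{E}_{P}\big[\,\mathbb{E}[Y\mid A=1,W]-\mathbb{E}[Y\mid A=0,W]\,\big]=\theta .$$ -/

import Mathlib

open MeasureTheory ProbabilityTheory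

/-- A directed acyclic graph on the vertex type `N`. -/
structure DAG (N : Type*) where
  /-- `edge u v` means `u → v`. -/
  edge : N → N → Prop
  acyclic : ∀ v, ¬ Relation.TransGen edge v v

namespace DAG

variable {N : Type*} (G : DAG N)

theorem wellFounded_edge [Finite N] : WellFounded G.edge := by
  have : Std.Irrefl (Relation.TransGen G.edge) := ⟨G.acyclic⟩
  exact Subrelation.wf (fun h => Relation.TransGen.single h)
    (Finite.wellFounded_of_trans_of_irrefl (Relation.TransGen G.edge))

/-- A path from `x` to `y`: a sequence of pairwise distinct vertices in which consecutive
vertices are joined by an edge, in either direction. -/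
def IsPath (p : List N) (x y : N) : Prop :=
  p.head? = some x ∧ p.getLast? = some y ∧ p.Nodup ∧
    p.IsChain (fun u v => G.edge u v ∨ G.edge v u)

/-- A path is open given `S` if every interior vertex that is a collider on the path is in `S`
or has a descendant in `S`, and no interior vertex that is a non-collider is in `S`. -/
def IsOpen (S : Set N) (p : List N) : Prop :=
  ∀ u v w, [u, v, w] <:+: p →
    ((G.edge u v ∧ G.edge w v) → ∃ s ∈ S, Relation.ReflTransGen G.edge v s) ∧
    (¬ (G.edge u v ∧ G.edge w v) → v ∉ S)

/-- `X` and `Y` are d-separated by `S`: every path from `X` to `Y` is blocked by `S`. It is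
only used for pairwise disjoint `X`, `Y`, `S`. -/
def DSep (X Y S : Set N) : Prop :=
  ∀ x ∈ X, ∀ y ∈ Y, ∀ p, G.IsPath p x y → ¬ G.IsOpen S p

/-- `W` satisfies the backdoor criterion relative to `(a, y)`: no vertex of `W` is a descendant
of `a`, and `W` blocks every path from `a` to `y` whose first edge points into `a`. -/
def BackdoorCriterion (a y : N) (W : Set N) : Prop :=
  (∀ w ∈ W, ¬ Relation.ReflTransGen G.edge a w) ∧
  ∀ p b, G.IsPath p a y → [a, b] <+: p → G.edge b a → ¬ G.IsOpen W p

/-- `ord` is a topological ordering of the graph. -/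
def IsTopologicalOrder (ord : N → ℕ) : Prop :=
  ∀ u v, G.edge u v → ord u < ord v

end DAG

/-- A structural causal model over the DAG `G`: real-valued variables `V_v` generated by
`V_v ← f_v (parents of v, ε_v)`, where the exogenous errors `ε_v` are mutually independent with
laws `noiseLaw v` on arbitrary measurable spaces. -/
structure SCM {N : Type*} (G : DAG N) where
  Noise : N → Type*
  [noiseSpace : ∀ v, MeasurableSpace (Noise v)]
  noiseLaw : ∀ v, Measure (Noise v)
  [isProb : ∀ v, IsProbabilityMeasure (noiseLaw v)]
  f : ∀ v, ({u // G.edge u v} → ℝ) × Noise v → ℝ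
  measurable_f : ∀ v, Measurable (f v)

attribute [instance] SCM.noiseSpace SCM.isProb

namespace SCM

variable {N : Type*} {G : DAG N} (M : SCM G)

/-- The model after the intervention `do(a = x)`: the structural equation of `a` is replaced by
the constant `x`, and all others are left as they are. -/
noncomputable def intervene [DecidableEq N] (a : N) (x : ℝ) : SCM G where
  Noise := M.Noise
  noiseLaw := M.noiseLaw
  f v := if v = a then fun _ => x else M.f v
  measurable_f v := by
    by_cases h : v = a
    · simp [h]
    · simpa [h] using M.measurable_f v

/-- The unique solution of the structural equations for given values of the errors. -/
noncomputable def solution [Finite N] (ε : ∀ v, M.Noise v) : N → ℝ :=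
  G.wellFounded_edge.fix (fun v rec => M.f v (fun u => rec u.1 u.2, ε v))

theorem solution_eq [Finite N] (ε : ∀ v, M.Noise v) (v : N) :
    M.solution ε v = M.f v (fun u => M.solution ε u.1, ε v) := by
  unfold solution
  rw [WellFounded.fix_eq]

theorem measurable_solution [Finite N] : Measurable M.solution := by
  refine measurable_pi_iff.2 fun v => ?_
  induction v using G.wellFounded_edge.induction with
  | _ v ih =>
    simp_rw [M.solution_eq _ v]
    exact (M.measurable_f v).comp
      ((measurable_pi_iff.2 fun u : {u // G.edge u v} => ih u.1 u.2).prodMk (measurable_pi_apply v))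

/-- The joint law of all variables, observed and latent. -/
noncomputable def law [Fintype N] : Measure (N → ℝ) :=
  (Measure.pi M.noiseLaw).map M.solution

instance [Fintype N] : IsProbabilityMeasure M.law :=
  Measure.isProbabilityMeasure_map M.measurable_solution.aemeasurable

section Observed

variable {V U : Type*} [Fintype V] [Fintype U] {G : DAG (V ⊕ U)} (M : SCM G)

/-- The joint law of the observed variables `V`, in a model with latent variables `U`. -/
noncomputable def obsLaw : Measure (V → ℝ) :=
  M.law.map (fun x v => x (Sum.inl v))

instance : IsProbabilityMeasure M.obsLaw :=
  Measure.isProbabilityMeasure_map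
    (measurable_pi_iff.2 fun v => measurable_pi_apply (Sum.inl v)).aemeasurable

/-- The joint law of the observed variables under the intervention `do(A = x)`. -/
noncomputable def doLaw [DecidableEq V] [DecidableEq U] (A : V) (x : ℝ) : Measure (V → ℝ) :=
  (M.intervene (Sum.inl A) x).obsLaw

/-- The average causal effect `E[Y | do(A = 1)] - E[Y | do(A = 0)]`. -/
noncomputable def averageCausalEffect [DecidableEq V] [DecidableEq U] (A Y : V) : ℝ :=
  (∫ v, v Y ∂(M.doLaw A 1)) - ∫ v, v Y ∂(M.doLaw A 0)

end Observed

end SCM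

section ObservedLaw

variable {V : Type*} [Finite V] (P : Measure (V → ℝ)) [IsProbabilityMeasure P]

/-- Under the joint law `P`, the variables in `X` are conditionally independent of those in `Y`
given those in `S`. -/
def CI (X Y S : Finset V) : Prop :=
  CondIndepFun (MeasurableSpace.comap (S.restrict (π := fun _ => ℝ)) inferInstance)
    (S.measurable_restrict (X := fun _ => ℝ)).comap_le
    (X.restrict (π := fun _ => ℝ)) (Y.restrict (π := fun _ => ℝ)) P

/-- The observed law `P` is faithful to the DAG `G` with latent vertices `U`: among the observed
variables, conditional independence in `P` is the same as d-separation in `G`. -/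
def Faithful {U : Type*} (G : DAG (V ⊕ U)) : Prop :=
  ∀ X Y S : Finset V, Disjoint X Y → Disjoint X S → Disjoint Y S →
    (G.DSep (Sum.inl '' (X : Set V)) (Sum.inl '' (Y : Set V)) (Sum.inl '' (S : Set V)) ↔
      CI P X Y S)

/-- Positivity: every event about `W` of positive probability has positive probability jointly
with `A = a`. -/
def Positivity (A : V) (a : ℝ) (W : Finset V) : Prop :=
  ∀ B : Set (W → ℝ), MeasurableSet B →
    P {v | W.restrict v ∈ B} ≠ 0 → P {v | v A = a ∧ W.restrict v ∈ B} ≠ 0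

/-- The conditional law of `Y` given `A = a` and `W = w`. -/
noncomputable def outcomeLaw (A Y : V) (W : Finset V) (a : ℝ) (w : W → ℝ) : Measure ℝ :=
  condDistrib (fun v : V → ℝ => v Y) (fun v : V → ℝ => (v A, W.restrict v)) P (a, w)

/-- The outcome regression `E[Y | A = a, W = w]`. -/
noncomputable def outcomeMean (A Y : V) (W : Finset V) (a : ℝ) (w : W → ℝ) : ℝ :=
  ∫ y, y ∂(outcomeLaw P A Y W a w)

/-- The expectations `E[Y | A = a, W]` and `E[E[Y | A = a, W]]` exist. -/
def RegressionIntegrable (A Y : V) (W : Finset V) (a : ℝ) : Prop :=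
  (∀ᵐ v ∂P, Integrable (fun y : ℝ => y) (outcomeLaw P A Y W a (W.restrict v))) ∧
    Integrable (fun v => outcomeMean P A Y W a (W.restrict v)) P

/-- The backdoor formula `E[ E[Y | A = 1, W] - E[Y | A = 0, W] ]`, where the outer expectation
is over the marginal law of `W`. -/
noncomputable def backdoorFormula (A Y : V) (W : Finset V) : ℝ :=
  ∫ v, (outcomeMean P A Y W 1 (W.restrict v) - outcomeMean P A Y W 0 (W.restrict v)) ∂P

end ObservedLaw

/-!
The argument has a graphical and a probabilistic half.

*The graph.* By faithfulness the conditional independence that `β` tests says that `Y` and `Z` are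
d-separated by `A` and `W`. An open backdoor path from `A` to `Y` would contradict this: preceded
by `Z → A`, it makes `A` a collider in the conditioning set and so gives an open path from `Z` to
`Y` (if `Z` lies on the path already, its final part does). This is `DAG.DSep.backdoorCriterion`.

*Ignorability.* Let all children of `A` receive the constant `x` in place of `A`, but let `A` keep
its own equation (`SCM.singleWorld`). The graph of this model has no edges out of `A`, so its
paths from `A` to `Y` are the backdoor paths, and `W` d-separates `A` from `Y` in it. Its
variables include the factual `A` and `W` and the counterfactual `Y(x)`. The global Markov property
(`SCM.condIndepSigma_of_dSep`) therefore makes `A` and `Y(x)` independent given `W`.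

The Markov property is proved without densities. D-separation splits the vertices into two parts,
one with `A` and one with `Y`, such that parents outside `W` lie in the part of their child
wherever this matters, that is, at the ancestors of `W` and of the two vertices
(`DAG.DSep.exists_partition`). The errors of the two parts are independent. Revealing the
variables of `W` in topological order keeps them conditionally independent, as each is a function
of the errors of one part and of what has been revealed before (`SCM.condIndepSigma_noise`).
Finally `A` and `Y(x)` are functions of `W` and of the errors of their own parts.

*Standardization.* Since `Y = Y(x)` where `A = x`, ignorability identifies the law of `Y` given
`A = x` and `W` with that of `Y(x)` given `W`, by positivity for almost every value of `W`; averaging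
over `W` gives `E[Y(x)] = E[Y | do(A = x)]` (`SCM.regression_eq_of_backdoor`).
-/

/-! ### Open paths and the partition given by d-separation -/

namespace DAG

variable {N : Type*} (G : DAG N)

/-- `v` belongs to `S` or is an ancestor of a vertex in `S`. -/
def Anc (S : Set N) (v : N) : Prop := ∃ s ∈ S, Relation.ReflTransGen G.edge v s

/-- `p` is an open path given `S` between `v` and `a`, listed from `v`, and it stays open if it is
prolonged beyond `v` by an edge `u → v` from a new vertex `u`. Then `v` is a collider if the first
edge of `p` points into `v`, and so has to be an ancestor of `S`; otherwise it has to lie outside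
`S`. Equivalently, the error of `v` is d-connected to `a` given `S`. -/
structure ReachesUp (S : Set N) (p : List N) (v a : N) : Prop where
  isPath : G.IsPath p v a
  isOpen : G.IsOpen S p
  anc : ∀ n r, p = v :: n :: r → G.edge n v → G.Anc S v
  notMem : (∀ n r, p = v :: n :: r → ¬ G.edge n v) → v ∉ S

variable {G}

theorem edge_asymm {u v : N} (h : G.edge u v) : ¬ G.edge v u := fun h' =>
  G.acyclic u (.tail (.single h) h')

theorem edge_ne {u v : N} (h : G.edge u v) : u ≠ v := by
  rintro rfl; exact edge_asymm h h

theorem IsOpen.mono {S : Set N} {p q : List N} (h : G.IsOpen S p) (hq : q <:+: p) :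
    G.IsOpen S q := fun u v w huvw => h u v w (huvw.trans hq)

theorem IsPath.suffix {l r : List N} {v u a : N} (h : G.IsPath (l ++ u :: r) v a) :
    G.IsPath (u :: r) u a := by
  obtain ⟨_, h2, h3, h4⟩ := h
  refine ⟨rfl, ?_, h3.of_append_right, h4.right_of_append⟩
  simpa [List.getLast?_append] using h2

theorem IsPath.cons {p : List N} {v u a : N} (h : G.IsPath p v a) (hu : u ∉ p)
    (huv : G.edge u v ∨ G.edge v u) : G.IsPath (u :: p) u a := by
  obtain ⟨h1, h2, h3, h4⟩ := h
  obtain ⟨r, rfl⟩ : ∃ r, p = v :: r := by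
    cases p with
    | nil => simp at h1
    | cons b r => exact ⟨r, by simpa using h1⟩
  exact ⟨rfl, by simpa using h2, List.nodup_cons.2 ⟨hu, h3⟩,
    by simp [List.isChain_cons_cons, huv, h4]⟩

theorem IsPath.eq_cons {p : List N} {v a : N} (h : G.IsPath p v a) : ∃ r, p = v :: r := by
  cases p with
  | nil => simp [IsPath] at h
  | cons b r => exact ⟨r, by simpa using h.1⟩

theorem IsPath.reverse {p : List N} {v a : N} (h : G.IsPath p v a) : G.IsPath p.reverse a v := by
  obtain ⟨h1, h2, h3, h4⟩ := h
  refine ⟨by simpa using h2, by simpa using h1, List.nodup_reverse.2 h3, ?_⟩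
  rw [List.isChain_reverse]
  exact h4.imp fun _ _ h => h.symm

theorem IsOpen.reverse {S : Set N} {p : List N} (h : G.IsOpen S p) : G.IsOpen S p.reverse := by
  intro u v w huvw
  have := h w v u (by simpa using List.reverse_infix.2 huvw)
  rwa [and_comm (a := G.edge u v)]

/-- Prolonging an open path by one edge only adds the status of its first vertex as an interior
vertex to the openness condition. -/
theorem IsOpen.cons {S : Set N} {u v : N} {r : List N} (h : G.IsOpen S (v :: r))
    (hv : ∀ n r', r = n :: r' → ((G.edge u v ∧ G.edge n v) → G.Anc S v) ∧
      (¬ (G.edge u v ∧ G.edge n v) → v ∉ S)) : G.IsOpen S (u :: v :: r) := by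
  intro x y z hxyz
  rcases List.infix_cons_iff.1 hxyz with hp | hi
  · obtain ⟨r', hr'⟩ := hp
    simp only [List.cons_append, List.nil_append, List.cons.injEq] at hr'
    obtain ⟨rfl, rfl, rfl⟩ := hr'
    exact hv z r' rfl
  · exact h x y z hi

/-- If an edge of such a path points into `u`, towards the first vertex of the path, then `u` is an
ancestor of `S`: from `u` on, the path follows arrows until it meets a collider, or arrives at its
first vertex. -/
theorem ReachesUp.anc_of_edge {S : Set N} {p : List N} {v a : N} (h : G.ReachesUp S p v a)
    (l : List N) : ∀ u n r, p = l ++ u :: n :: r → G.edge n u → G.Anc S u := by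
  induction l using List.reverseRecOn with
  | nil =>
    intro u n r hp hnu
    obtain ⟨r', hr'⟩ := h.isPath.eq_cons
    obtain rfl : u = v := by rw [hr'] at hp; simpa using (List.cons.inj hp).1.symm
    exact h.anc n r hp hnu
  | append_singleton l m ih =>
    intro u n r hp hnu
    have hinf : [m, u, n] <:+: p := ⟨l, r, by simp [hp]⟩
    by_cases hmu : G.edge m u
    · exact (h.isOpen m u n hinf).1 ⟨hmu, hnu⟩
    · have hch : G.edge m u ∨ G.edge u m := by
        have := h.isPath.2.2.2.infix (l₁ := [m, u]) ⟨l, n :: r, by simp [hp]⟩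
        simpa [List.isChain_cons_cons] using this
      have hum := hch.resolve_left hmu
      obtain ⟨s, hs, hms⟩ := ih m u (n :: r) (by simp [hp]) hum
      exact ⟨s, hs, .head hum hms⟩

theorem ReachesUp.suffix {S : Set N} {p l r : List N} {v u a : N} (h : G.ReachesUp S p v a)
    (hp : p = l ++ u :: r) (hu : u ∉ S) : G.ReachesUp S (u :: r) u a := by
  refine ⟨(hp ▸ h.isPath).suffix, h.isOpen.mono (hp ▸ (List.suffix_append _ _).isInfix), ?_,
    fun _ => hu⟩
  rintro n r' hr' hnu
  rw [hr'] at hp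
  exact h.anc_of_edge l u n r' hp hnu

/-- If `S` d-separates `a` from `y`, the vertices split into two parts, one with `a` and one with
`y`, such that every vertex of the first part, and every vertex of the second that is an ancestor
of `S` or of `y`, has all its parents in its own part or in `S`. -/
theorem DSep.exists_partition {S : Set N} {a y : N} (h : G.DSep {a} {y} S) (ha : a ∉ S) :
    ∃ K : Set N, a ∈ K ∧ y ∉ K ∧ (∀ u v, v ∈ K → G.edge u v → u ∈ K ∨ u ∈ S) ∧
      ∀ u v, v ∉ K → G.Anc (insert y S) v → G.edge u v → u ∉ K ∨ u ∈ S := by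
  have hsep : ∀ p, G.IsPath p y a → ¬ G.IsOpen S p := fun p hp ho =>
    h a rfl y rfl p.reverse hp.reverse ho.reverse
  -- the part of `a` consists of the vertices whose errors are d-connected to `a`
  refine ⟨{v | ∃ p, G.ReachesUp S p v a}, ⟨[a], ⟨rfl, rfl, by simp, by simp⟩, ?_, by simp,
    fun _ => ha⟩, fun ⟨p, hp⟩ => hsep p hp.isPath hp.isOpen, ?_, ?_⟩
  · intro u v w huvw
    simpa using huvw.length_le
  · rintro u v ⟨p, hp⟩ huv
    by_cases hu : u ∈ S
    · exact .inr hu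
    left
    by_cases hup : u ∈ p
    · obtain ⟨l, r, hlr⟩ := List.append_of_mem hup
      exact ⟨_, hp.suffix hlr hu⟩
    obtain ⟨r, rfl⟩ := hp.isPath.eq_cons
    refine ⟨_, hp.isPath.cons hup (.inl huv), hp.isOpen.cons ?_, ?_, fun _ => hu⟩
    · rintro n r' rfl
      refine ⟨fun ⟨_, hnv⟩ => hp.anc n r' rfl hnv, fun hcol => hp.notMem ?_⟩
      intro n' r'' heq hn'
      obtain rfl : n = n' := by simp at heq; exact heq.1
      exact hcol ⟨huv, hn'⟩
    · intro n r' heq hnu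
      obtain rfl : v = n := by simp at heq; exact heq.1
      exact (edge_asymm huv hnu).elim
  · intro u v hv hanc huv
    by_contra! hcon
    obtain ⟨⟨p, hp⟩, hu⟩ := hcon
    by_cases hvp : v ∈ p
    · obtain ⟨l, r, hlr⟩ := List.append_of_mem hvp
      by_cases hvS : v ∈ S
      · refine hv ⟨v :: r, (hlr ▸ hp.isPath).suffix,
          hp.isOpen.mono (hlr ▸ (List.suffix_append _ _).isInfix),
          fun _ _ _ _ => ⟨v, hvS, .refl⟩, fun hno => ?_⟩
        -- `v` is an interior vertex of `p`, not a collider, and in `S`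
        exfalso
        rcases l.eq_nil_or_concat with rfl | ⟨l, m, rfl⟩
        · obtain ⟨r', hr'⟩ := hp.isPath.eq_cons
          rw [hr'] at hlr
          exact edge_ne huv (List.cons.inj hlr).1
        cases r with
        | nil =>
          have := hp.isPath.2.1
          simp [hlr] at this
          exact ha (this ▸ hvS)
        | cons n r =>
          exact (hp.isOpen m v n ⟨l, r, by simp [hlr]⟩).2 (fun hc => hno n r rfl hc.2) hvS
      · exact hv ⟨_, hp.suffix hlr hvS⟩
    obtain ⟨r, rfl⟩ := hp.isPath.eq_cons
    have hpath := hp.isPath.cons hvp (.inr huv)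
    have hopen : G.IsOpen S (v :: u :: r) := hp.isOpen.cons fun n r' _ =>
      ⟨fun hc => (edge_asymm huv hc.1).elim, fun _ => hu⟩
    have hvS : ¬ G.Anc S v := fun hA => hv ⟨_, hpath, hopen, fun _ _ _ _ => hA, fun hno =>
      (hno u r rfl huv).elim⟩
    obtain ⟨s, hs, hvs⟩ := hanc
    obtain rfl : s = y := hs.resolve_right fun hs => hvS ⟨s, hs, hvs⟩
    -- an open path to a non-ancestor of `S` is prolonged along a directed path from there to `s`
    have key : ∀ c, Relation.ReflTransGen G.edge c s → ∀ q, G.IsPath q c a → G.IsOpen S q →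
        ¬ G.Anc S c → False := by
      intro c hcs
      induction hcs using Relation.ReflTransGen.head_induction_on with
      | refl => exact fun q hq ho _ => hsep q hq ho
      | @head c d hcd _ ih =>
        intro q hq ho hc
        have hd : ¬ G.Anc S d := fun ⟨t, ht, hdt⟩ => hc ⟨t, ht, .head hcd hdt⟩
        by_cases hdq : d ∈ q
        · obtain ⟨l, r, rfl⟩ := List.append_of_mem hdq
          exact ih _ hq.suffix (ho.mono (List.suffix_append _ _).isInfix) hd
        · obtain ⟨r, rfl⟩ := hq.eq_cons
          exact ih _ (hq.cons hdq (.inr hcd)) (ho.cons fun n r' _ =>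
            ⟨fun hc' => (edge_asymm hcd hc'.1).elim, fun _ hcS => hc ⟨c, hcS, .refl⟩⟩) hd
    exact key v hvs _ hpath hopen hvS

/-! ### Backdoor paths -/

/-- The graph without the edges out of `a`. -/
def cutOut (G : DAG N) (a : N) : DAG N where
  edge u v := G.edge u v ∧ u ≠ a
  acyclic v h := G.acyclic v (Relation.TransGen.mono (p := G.edge) (fun _ _ h => h.1) _ _ h)

/-- Backdoor paths are exactly the paths that survive the removal of the edges out of `a`. -/
theorem BackdoorCriterion.dSep_cutOut {a y : N} {S : Set N} (h : G.BackdoorCriterion a y S)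
    (hay : a ≠ y) : (G.cutOut a).DSep {a} {y} S := by
  intro a' ha' y' hy' p hp ho
  obtain rfl : a' = a := ha'
  obtain rfl : y' = y := hy'
  have hp' : G.IsPath p a' y' :=
    ⟨hp.1, hp.2.1, hp.2.2.1, hp.2.2.2.imp fun _ _ h =>
      h.imp (fun h => h.1) (fun h => h.1)⟩
  obtain ⟨r, rfl⟩ := hp.eq_cons
  cases r with
  | nil => exact hay (by simpa using hp.2.1)
  | cons b r =>
    have hba : G.edge b a' := by
      have := (List.isChain_cons_cons.1 hp.2.2.2).1
      exact (this.resolve_left fun h => h.2 rfl).1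
    refine h.2 _ b hp' ⟨r, rfl⟩ hba fun u v w huvw => ?_
    have hch := hp.2.2.2.infix huvw
    simp only [List.isChain_cons_cons, List.isChain_singleton, and_true] at hch
    have huv : G.edge u v ↔ (G.cutOut a').edge u v :=
      ⟨fun h => hch.1.resolve_right fun h' => edge_asymm h h'.1, And.left⟩
    have hwv : G.edge w v ↔ (G.cutOut a').edge w v :=
      ⟨fun h => hch.2.resolve_left fun h' => edge_asymm h h'.1, And.left⟩
    obtain ⟨h1, h2⟩ := ho u v w huvw
    rw [huv, hwv]
    refine ⟨fun hc => ?_, h2⟩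
    obtain ⟨s, hs, hvs⟩ := h1 hc
    exact ⟨s, hs, Relation.ReflTransGen.mono (p := G.edge) (fun _ _ h => h.1) _ _ hvs⟩

/-- An open backdoor path from `a` to `y` yields an open path from `z` to `y` given `a` and `S`,
since the edge `z → a` makes `a` a collider in the conditioning set; hence d-separation of `y` from
`z` excludes such paths. -/
theorem DSep.backdoorCriterion {z a y : N} {S : Set N} (hza : G.edge z a)
    (hS : ∀ w ∈ S, ¬ Relation.ReflTransGen G.edge a w) (h : G.DSep {y} {z} (insert a S)) :
    G.BackdoorCriterion a y S := by
  refine ⟨hS, fun p b hp hb hba ho => ?_⟩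
  -- `a` is not an interior vertex of `p`
  have ho' : G.IsOpen (insert a S) p := by
    intro u v w huvw
    obtain ⟨h1, h2⟩ := ho u v w huvw
    refine ⟨fun hc => (h1 hc).imp fun s hs => ⟨.inr hs.1, hs.2⟩, fun hc hv => ?_⟩
    rcases hv with rfl | hv
    · obtain ⟨l, r, rfl⟩ := huvw
      obtain ⟨r', hr'⟩ := hp.eq_cons
      have hnd := hp.2.2.1
      rw [hr'] at hnd
      refine (List.nodup_cons.1 hnd).1 ?_
      cases l <;> simp at hr' <;> simp [← hr'.2]
    · exact h2 hc hv
  have hsep : ∀ q, G.IsPath q z y → ¬ G.IsOpen (insert a S) q := fun q hq hqo =>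
    h y rfl z rfl q.reverse hq.reverse hqo.reverse
  by_cases hz : z ∈ p
  · obtain ⟨l, r, rfl⟩ := List.append_of_mem hz
    exact hsep _ hp.suffix (ho'.mono (List.suffix_append _ _).isInfix)
  · obtain ⟨r, rfl⟩ := hb
    refine hsep _ (hp.cons hz (.inl hza)) (ho'.cons fun n r' hn => ?_)
    obtain rfl : b = n := by simpa using (List.cons.inj hn).1
    exact ⟨fun _ => ⟨a, .inl rfl, .refl⟩, fun hc => (hc ⟨hza, hba⟩).elim⟩

end DAG

/-! ### Conditional independence of σ-algebras -/

/-- Conditional independence of the σ-algebras `m₁` and `m₂` given `m'`, stated as follows: for an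
event of `m₂`, the additional knowledge of `m₁` does not change its probability given `m'`. Unlike
`ProbabilityTheory.CondIndep` this makes sense on spaces that are not standard Borel, such as
the space of the errors of a structural causal model. -/
def CondIndepSigma {Ω : Type*} (m' m₁ m₂ : MeasurableSpace Ω)
    {_mΩ : MeasurableSpace Ω} (μ : Measure Ω) : Prop :=
  ∀ t, MeasurableSet[m₂] t →
    μ[t.indicator (fun _ => (1 : ℝ)) | m₁ ⊔ m'] =ᵐ[μ] μ[t.indicator (fun _ => (1 : ℝ)) | m']

namespace CondIndepSigma

variable {Ω : Type*} {m' m'' m₁ m₂ m₃ : MeasurableSpace Ω} {mΩ : MeasurableSpace Ω}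
  {μ : Measure Ω}

theorem sup_left (h : CondIndepSigma m' m₁ m₂ μ) : CondIndepSigma m' (m₁ ⊔ m') m₂ μ := by
  intro t ht
  rw [sup_assoc, sup_idem]
  exact h t ht

variable [IsProbabilityMeasure μ]

theorem of_indep (h₁ : m₁ ≤ mΩ) (h₂ : m₂ ≤ mΩ) (h : Indep m₁ m₂ μ) :
    CondIndepSigma ⊥ m₁ m₂ μ := by
  intro t ht
  rw [sup_bot_eq, condExp_bot]
  exact condExp_indep_eq h₂ h₁ (stronglyMeasurable_const.indicator ht) h.symm

/-- Conditioning on a σ-algebra between `m'` and `m₁ ⊔ m'` preserves conditional independence. -/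
theorem of_le_sup (h : CondIndepSigma m' m₁ m₂ μ) (h₁ : m₁ ≤ mΩ)
    (h' : m' ≤ mΩ) (hle : m' ≤ m'') (hle' : m'' ≤ m₁ ⊔ m') : CondIndepSigma m'' m₁ m₂ μ := by
  intro t ht
  have hs : m₁ ⊔ m'' = m₁ ⊔ m' := le_antisymm (sup_le le_sup_left hle') (sup_le_sup_left hle _)
  have hle0 : m₁ ⊔ m' ≤ mΩ := sup_le h₁ h'
  rw [hs]
  refine (h t ht).trans ?_
  have h1 := condExp_condExp_of_le (μ := μ) (f := t.indicator (fun _ => (1 : ℝ))) hle' hle0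
  have h2 := condExp_congr_ae (m := m'') (h t ht)
  rw [condExp_of_stronglyMeasurable (hle'.trans hle0) (stronglyMeasurable_condExp.mono hle)
    integrable_condExp] at h2
  exact h2.symm.trans h1

theorem mono_left (h : CondIndepSigma m' m₁ m₂ μ) (h₁ : m₁ ≤ mΩ)
    (h' : m' ≤ mΩ) (h₃ : m₃ ≤ m₁) :
    CondIndepSigma m' m₃ m₂ μ := by
  intro t ht
  have hle0 : m₁ ⊔ m' ≤ mΩ := sup_le h₁ h'
  have hle : m₃ ⊔ m' ≤ m₁ ⊔ m' := sup_le_sup_right h₃ _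
  have h1 := condExp_condExp_of_le (μ := μ) (f := t.indicator (fun _ => (1 : ℝ))) hle hle0
  have h2 := condExp_congr_ae (m := m₃ ⊔ m') (h t ht)
  rw [condExp_of_stronglyMeasurable (hle.trans hle0) (stronglyMeasurable_condExp.mono le_sup_right)
    integrable_condExp] at h2
  exact h1.symm.trans h2

theorem condExp_inter (h : CondIndepSigma m' m₁ m₂ μ) (h₁ : m₁ ≤ mΩ) (h₂ : m₂ ≤ mΩ)
    (h' : m' ≤ mΩ) {s t : Set Ω} (hs : MeasurableSet[m₁] s) (ht : MeasurableSet[m₂] t) :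
    μ[(s ∩ t).indicator (fun _ => (1 : ℝ)) | m'] =ᵐ[μ]
      μ[s.indicator (fun _ => (1 : ℝ)) | m'] * μ[t.indicator (fun _ => (1 : ℝ)) | m'] := by
  have hle0 : m₁ ⊔ m' ≤ mΩ := sup_le h₁ h'
  have hit : Integrable (t.indicator (fun _ => (1 : ℝ))) μ :=
    (integrable_const 1).indicator (h₂ t ht)
  have his : Integrable (s.indicator (fun _ => (1 : ℝ))) μ :=
    (integrable_const 1).indicator (h₁ s hs)
  have hst : (s ∩ t).indicator (fun _ => (1 : ℝ)) =
      s.indicator (t.indicator (fun _ => (1 : ℝ))) := by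
    rw [Set.indicator_indicator]
  have e1 : μ[(s ∩ t).indicator (fun _ => (1 : ℝ)) | m₁ ⊔ m'] =ᵐ[μ]
      s.indicator (μ[t.indicator (fun _ => (1 : ℝ)) | m']) := by
    rw [hst]
    refine (condExp_indicator hit (le_sup_left (a := m₁) (b := m') s hs)).trans ?_
    filter_upwards [h t ht] with ω hω
    by_cases hωs : ω ∈ s <;> simp [hωs, hω]
  have e2 : s.indicator (μ[t.indicator (fun _ => (1 : ℝ)) | m']) =
      s.indicator (fun _ => (1 : ℝ)) * μ[t.indicator (fun _ => (1 : ℝ)) | m'] := by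
    ext ω
    by_cases hωs : ω ∈ s <;> simp [hωs]
  refine (condExp_condExp_of_le (μ := μ) le_sup_right hle0).symm.trans
    ((condExp_congr_ae e1).trans ?_)
  rw [e2]
  refine condExp_mul_of_stronglyMeasurable_right stronglyMeasurable_condExp ?_ his
  rw [← e2]
  exact integrable_condExp.indicator (h₁ s hs)

/-- The definition is asymmetric in `m₁` and `m₂`; symmetry comes from the product form
`condExp_inter`, by comparing integrals over the events `t ∩ c` that generate `m₂ ⊔ m'`. -/
theorem symm (h : CondIndepSigma m' m₁ m₂ μ) (h₁ : m₁ ≤ mΩ) (h₂ : m₂ ≤ mΩ)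
    (h' : m' ≤ mΩ) : CondIndepSigma m' m₂ m₁ μ := by
  intro s hs
  have hle0 : m₂ ⊔ m' ≤ mΩ := sup_le h₂ h'
  have his : Integrable (s.indicator (fun _ => (1 : ℝ))) μ :=
    (integrable_const 1).indicator (h₁ s hs)
  set g := μ[s.indicator (fun _ => (1 : ℝ)) | m'] with hg
  have hgi : Integrable g μ := integrable_condExp
  have hgm : StronglyMeasurable[m₂ ⊔ m'] g :=
    (stronglyMeasurable_condExp (m := m')).mono le_sup_right
  refine (ae_eq_condExp_of_forall_setIntegral_eq hle0 his (fun _ _ _ => hgi.integrableOn) ?_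
    hgm.aestronglyMeasurable).symm
  intro u hu _
  -- both sides agree on the events `t ∩ c` with `t` in `m₂` and `c` in `m'`
  have hgen : m₂ ⊔ m' = MeasurableSpace.generateFrom
      (Set.image2 (· ∩ ·) {t | MeasurableSet[m₂] t} {c | MeasurableSet[m'] c}) := by
    refine le_antisymm (sup_le (fun t ht => ?_) fun c hc => ?_) ?_
    · exact MeasurableSpace.measurableSet_generateFrom ⟨t, ht, Set.univ, .univ, by simp⟩
    · exact MeasurableSpace.measurableSet_generateFrom ⟨Set.univ, .univ, c, hc, by simp⟩
    · refine MeasurableSpace.generateFrom_le ?_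
      rintro _ ⟨t, ht, c, hc, rfl⟩
      exact (le_sup_left (a := m₂) (b := m') t ht).inter (le_sup_right (a := m₂) (b := m') c hc)
  have hpi : IsPiSystem
      (Set.image2 (· ∩ ·) {t | MeasurableSet[m₂] t} {c | MeasurableSet[m'] c}) := by
    rintro _ ⟨t, ht, c, hc, rfl⟩ _ ⟨t', ht', c', hc', rfl⟩ _
    exact ⟨t ∩ t', ht.inter ht', c ∩ c', hc.inter hc', Set.inter_inter_inter_comm _ _ _ _⟩
  induction u, hu using MeasurableSpace.induction_on_inter hgen hpi with
  | empty => simp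
  | basic u hu =>
    obtain ⟨t, ht, c, hc, rfl⟩ := hu
    have hit : Integrable (t.indicator (fun _ => (1 : ℝ))) μ :=
      (integrable_const 1).indicator (h₂ t ht)
    have hti : Integrable (t.indicator g) μ := hgi.indicator (h₂ t ht)
    have e : t.indicator g = g * t.indicator (fun _ => (1 : ℝ)) := by
      ext ω
      by_cases hωs : ω ∈ t <;> simp [hωs]
    have e1 : μ[t.indicator g | m'] =ᵐ[μ] μ[(s ∩ t).indicator (fun _ => (1 : ℝ)) | m'] := by
      rw [e]
      exact (condExp_mul_of_stronglyMeasurable_left stronglyMeasurable_condExp (e ▸ hti) hit).trans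
        (h.condExp_inter h₁ h₂ h' hs ht).symm
    calc ∫ x in t ∩ c, g x ∂μ = ∫ x in c, t.indicator g x ∂μ := by
          rw [Set.inter_comm, setIntegral_indicator (h₂ t ht)]
      _ = ∫ x in c, (μ[t.indicator g | m']) x ∂μ := (setIntegral_condExp h' hti hc).symm
      _ = ∫ x in c, (μ[(s ∩ t).indicator (fun _ => (1 : ℝ)) | m']) x ∂μ :=
          integral_congr_ae (ae_restrict_of_ae e1)
      _ = ∫ x in c, (s ∩ t).indicator (fun _ => (1 : ℝ)) x ∂μ :=
          setIntegral_condExp h' ((integrable_const 1).indicator ((h₁ s hs).inter (h₂ t ht))) hc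
      _ = ∫ x in t ∩ c, s.indicator (fun _ => (1 : ℝ)) x ∂μ := by
          rw [Set.inter_comm t c, ← setIntegral_indicator (h₂ t ht), Set.indicator_indicator,
            Set.inter_comm]
  | compl u hu ih =>
    have hu' := hle0 u hu
    have e1 := integral_add_compl hu' hgi
    have e2 := integral_add_compl hu' his
    have e3 : ∫ x, g x ∂μ = ∫ x, s.indicator (fun _ => (1 : ℝ)) x ∂μ := integral_condExp h'
    linarith [ih (measure_lt_top _ _)]
  | iUnion f hd hf ih =>
    have hf' := fun i => hle0 _ (hf i)
    rw [integral_iUnion hf' hd hgi.integrableOn, integral_iUnion hf' hd his.integrableOn]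
    exact tsum_congr fun i => ih i (measure_lt_top _ _)

end CondIndepSigma

/-! ### The global Markov property -/

theorem DAG.IsTopologicalOrder.lt_of_transGen {N : Type*} {G : DAG N} {ord : N → ℕ}
    (h : G.IsTopologicalOrder ord) {u v : N} (huv : Relation.TransGen G.edge u v) :
    ord u < ord v := by
  induction huv with
  | single huv => exact h _ _ huv
  | tail _ huv ih => exact ih.trans (h _ _ huv)

namespace SCM

section Markov

variable {N : Type*} {G : DAG N} (M : SCM G)

/-- The σ-algebra generated by the errors of the vertices in `R`. -/
@[reducible]
def noiseSigma (R : Set N) : MeasurableSpace (∀ v, M.Noise v) :=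
  ⨆ v ∈ R, MeasurableSpace.comap (fun ε : ∀ v, M.Noise v => ε v) (M.noiseSpace v)

/-- The σ-algebra generated by the variables in `s`, on the space of the errors. -/
@[reducible]
noncomputable def varSigma [Finite N] (s : Set N) : MeasurableSpace (∀ v, M.Noise v) :=
  ⨆ w ∈ s, MeasurableSpace.comap (fun ε => M.solution ε w) inferInstance

theorem noiseSigma_le (R : Set N) : M.noiseSigma R ≤ MeasurableSpace.pi :=
  iSup₂_le fun v _ => (measurable_pi_apply v).comap_le

theorem measurable_solution_apply [Finite N] (v : N) : Measurable fun ε => M.solution ε v :=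
  (measurable_pi_apply v).comp M.measurable_solution

theorem varSigma_le [Finite N] (s : Set N) : M.varSigma s ≤ MeasurableSpace.pi :=
  iSup₂_le fun v _ => (M.measurable_solution_apply v).comap_le

/-- A variable of the part `R` is a function of the errors of `R` and of the variables of `S` that
precede it, provided that parents always lie in `R` or in `S`. Here `D` is any set of vertices
closed under parents outside of which the condition is not needed. -/
theorem measurable_solution_of_parents [Finite N] {R D S s : Set N}
    (hD : ∀ u v, v ∈ D → G.edge u v → u ∈ D)
    (hR : ∀ u v, v ∈ R → v ∈ D → G.edge u v → u ∈ R ∨ u ∈ S) (v : N) (hvR : v ∈ R) (hvD : v ∈ D)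
    (hs : ∀ w ∈ S, Relation.TransGen G.edge w v → w ∈ s) :
    Measurable[M.noiseSigma R ⊔ M.varSigma s] fun ε => M.solution ε v := by
  induction v using G.wellFounded_edge.induction with
  | _ v ih =>
    simp_rw [M.solution_eq _ v]
    refine (M.measurable_f v).comp (Measurable.prodMk
      (@measurable_pi_lambda _ _ _ (_) _ _ fun u => ?_) ?_)
    · by_cases hu : u.1 ∈ S
      · have hus : u.1 ∈ s := hs _ hu (.single u.2)
        exact (comap_measurable _).mono
          ((le_iSup₂ (f := fun w (_ : w ∈ s) => MeasurableSpace.comap (fun ε => M.solution ε w)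
            inferInstance) u.1 hus).trans le_sup_right) le_rfl
      · exact ih u.1 u.2 ((hR _ _ hvR hvD u.2).resolve_right hu) (hD _ _ hvD u.2)
          fun w hw hwu => hs w hw (hwu.tail u.2)
    · exact (comap_measurable _).mono
        ((le_iSup₂ (f := fun v (_ : v ∈ R) => MeasurableSpace.comap (fun ε : ∀ v, M.Noise v => ε v)
            (M.noiseSpace v)) v hvR).trans le_sup_left) le_rfl

theorem indep_noiseSigma_compl [Fintype N] (K : Set N) :
    Indep (M.noiseSigma K) (M.noiseSigma Kᶜ) (Measure.pi M.noiseLaw) := by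
  have h : iIndepFun (fun v (ε : ∀ v, M.Noise v) => ε v) (Measure.pi M.noiseLaw) :=
    iIndepFun_pi (X := fun _ x => x) fun _ => aemeasurable_id
  exact indep_iSup_of_disjoint (fun v => (measurable_pi_apply v).comap_le) h disjoint_compl_right

/-- If all families of the vertices that matter stay within one of the two parts `K` and `Kᶜ`, up
to vertices of `S`, the errors of the two parts are conditionally independent given the variables
in `S`. The variables in `S` are revealed one after the other, in topological order; each is then a
function of the errors of one part and of what has been revealed before, which preserves
conditional independence. -/
theorem condIndepSigma_noise [Fintype N] {ord : N → ℕ} (hord : G.IsTopologicalOrder ord)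
    {K D : Set N} {S : Finset N} (hSD : (S : Set N) ⊆ D) (hD : ∀ u v, v ∈ D → G.edge u v → u ∈ D)
    (hK : ∀ u v, v ∈ K → v ∈ D → G.edge u v → u ∈ K ∨ u ∈ (S : Set N))
    (hK' : ∀ u v, v ∈ Kᶜ → v ∈ D → G.edge u v → u ∈ Kᶜ ∨ u ∈ (S : Set N)) :
    CondIndepSigma (M.varSigma S) (M.noiseSigma K) (M.noiseSigma Kᶜ) (Measure.pi M.noiseLaw) := by
  classical
  suffices H : ∀ s : Finset N, s ⊆ S →
      (∀ w ∈ S, ∀ w' ∈ s, Relation.TransGen G.edge w w' → w ∈ s) →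
      CondIndepSigma (M.varSigma s) (M.noiseSigma K) (M.noiseSigma Kᶜ) (Measure.pi M.noiseLaw) from
    H S subset_rfl fun w hw _ _ _ => hw
  intro s
  induction s using Finset.induction_on_max_value ord with
  | empty =>
    intro _ _
    have : M.varSigma (∅ : Finset N) = ⊥ := by simp [varSigma]
    rw [this]
    exact .of_indep (M.noiseSigma_le _) (M.noiseSigma_le _) (M.indep_noiseSigma_compl K)
  | insert a s _ hmax ih =>
    intro hsub hcl
    have haS : a ∈ S := hsub (Finset.mem_insert_self a s)
    have ih := ih ((Finset.subset_insert a s).trans hsub) fun w hw w' hw' hww' => by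
      refine (Finset.mem_insert.1 (hcl w hw w' (Finset.mem_insert_of_mem hw') hww')).resolve_left ?_
      rintro rfl
      exact absurd (hord.lt_of_transGen hww') (hmax w' hw').not_gt
    have hpre : ∀ w ∈ (S : Set N), Relation.TransGen G.edge w a → w ∈ (s : Set N) := by
      intro w hw hwa
      refine (Finset.mem_insert.1 (hcl w hw a (Finset.mem_insert_self a s) hwa)).resolve_left ?_
      rintro rfl
      exact G.acyclic _ hwa
    have heq : M.varSigma ((insert a s : Finset N) : Set N) =
        MeasurableSpace.comap (fun ε => M.solution ε a) inferInstance ⊔ M.varSigma s := by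
      rw [Finset.coe_insert, varSigma, iSup_insert]
    rw [heq]
    by_cases ha : a ∈ K
    · exact ih.of_le_sup (M.noiseSigma_le _) (M.varSigma_le _) le_sup_right (sup_le
        (M.measurable_solution_of_parents hD hK a ha (hSD haS) hpre).comap_le le_sup_right)
    · have hle : MeasurableSpace.comap (fun ε => M.solution ε a) inferInstance ⊔ M.varSigma s ≤
          M.noiseSigma Kᶜ ⊔ M.varSigma s := sup_le
        (M.measurable_solution_of_parents hD hK' a ha (hSD haS) hpre).comap_le le_sup_right
      exact ((ih.symm (M.noiseSigma_le _) (M.noiseSigma_le _) (M.varSigma_le _)).of_le_sup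
        (M.noiseSigma_le _) (M.varSigma_le _) le_sup_right hle).symm (M.noiseSigma_le _)
        (M.noiseSigma_le _) (hle.trans (sup_le (M.noiseSigma_le _) (M.varSigma_le _)))

/-- The global Markov property of structural causal models, for two single vertices. -/
theorem condIndepSigma_of_dSep [Fintype N] {ord : N → ℕ} (hord : G.IsTopologicalOrder ord)
    {S : Finset N} {a y : N} (ha : a ∉ S) (h : G.DSep {a} {y} S) :
    CondIndepSigma (M.varSigma S) (MeasurableSpace.comap (fun ε => M.solution ε a) inferInstance)
      (MeasurableSpace.comap (fun ε => M.solution ε y) inferInstance) (Measure.pi M.noiseLaw) := by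
  obtain ⟨K, haK, hyK, hK, hK'⟩ := h.exists_partition (by simpa using ha)
  set D : Set N := {v | G.Anc (insert y (S : Set N)) v}
  have hSD : (S : Set N) ⊆ D := fun s hs => ⟨s, .inr hs, .refl⟩
  have hD : ∀ u v, v ∈ D → G.edge u v → u ∈ D := fun u v ⟨s, hs, hvs⟩ huv => ⟨s, hs, .head huv hvs⟩
  have hnoise := M.condIndepSigma_noise hord hSD hD (fun u v hv _ => hK u v hv) hK'
  -- in the part of `a` the parent condition holds at all vertices, not only at those in `D`
  have hXa := (M.measurable_solution_of_parents (D := Set.univ) (s := S) (fun _ _ _ _ => trivial)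
    (fun u v hv _ => hK u v hv) a haK trivial fun w hw _ => hw).comap_le
  have hXy := (M.measurable_solution_of_parents (s := S) hD hK' y hyK ⟨y, .inl rfl, .refl⟩
    fun w hw _ => hw).comap_le
  have hS := M.varSigma_le (S : Set N)
  have h1 := hnoise.sup_left.mono_left (sup_le (M.noiseSigma_le _) hS) hS hXa
  have h2 := h1.symm (M.measurable_solution_apply a).comap_le (M.noiseSigma_le _) hS
  have h3 := h2.sup_left.mono_left (sup_le (M.noiseSigma_le _) hS) hS hXy
  exact h3.symm (M.measurable_solution_apply y).comap_le (M.measurable_solution_apply a).comap_le hS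

end Markov

/-! ### Counterfactuals in a single world -/

section SingleWorld

variable {N : Type*} {G : DAG N} (M : SCM G)

open Classical in
/-- The single-world model: every child of `a` receives the constant `x` in place of the value of
`a`, while `a` itself keeps its structural equation. Its graph has no edges out of `a`, and its
variables comprise the factual value of `a` together with the values of all other variables under
`do(a = x)`. -/
noncomputable def singleWorld (a : N) (x : ℝ) : SCM (G.cutOut a) where
  Noise := M.Noise
  noiseLaw := M.noiseLaw
  f v p := M.f v (fun u => if h : u.1 = a then x else p.1 ⟨u.1, u.2, h⟩, p.2)
  measurable_f v := by
    refine (M.measurable_f v).comp (Measurable.prodMk (measurable_pi_iff.2 fun u => ?_)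
      measurable_snd)
    by_cases h : u.1 = a
    · simp [h]
    · simp only [h, dite_false]
      exact (measurable_pi_apply _).comp measurable_fst

variable [Finite N]

open Classical in
theorem singleWorld_solution_eq (a : N) (x : ℝ) (ε : ∀ v, M.Noise v) (v : N) :
    (M.singleWorld a x).solution ε v =
      M.f v (fun u => if u.1 = a then x else (M.singleWorld a x).solution ε u.1, ε v) := by
  exact (M.singleWorld a x).solution_eq ε v

theorem singleWorld_solution_of_not_transGen (a : N) (x : ℝ) (ε : ∀ v, M.Noise v) (v : N)
    (hv : ¬ Relation.TransGen G.edge a v) :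
    (M.singleWorld a x).solution ε v = M.solution ε v := by
  induction v using G.wellFounded_edge.induction with
  | _ v ih =>
    rw [singleWorld_solution_eq, solution_eq]
    congr 2
    funext u
    have hua : u.1 ≠ a := fun h => hv (.single (h ▸ u.2))
    rw [if_neg hua]
    exact ih u.1 u.2 fun h => hv (h.tail u.2)

/-- Consistency: where `a` takes the value `x` anyway, the single-world model agrees with the
original one. -/
theorem singleWorld_solution_of_eq (a : N) (x : ℝ) (ε : ∀ v, M.Noise v)
    (hx : M.solution ε a = x) (v : N) : (M.singleWorld a x).solution ε v = M.solution ε v := by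
  induction v using G.wellFounded_edge.induction with
  | _ v ih =>
    rw [singleWorld_solution_eq, solution_eq]
    congr 2
    funext u
    split_ifs with h
    · rw [h, hx]
    · exact ih u.1 u.2

theorem singleWorld_solution_of_ne [DecidableEq N] (a : N) (x : ℝ) (ε : ∀ v, M.Noise v) (v : N)
    (hv : v ≠ a) : (M.singleWorld a x).solution ε v = (M.intervene a x).solution ε v := by
  induction v using G.wellFounded_edge.induction with
  | _ v ih =>
    have e : (M.intervene a x).solution ε v =
        M.f v (fun u => (M.intervene a x).solution ε u.1, ε v) := by
      refine ((M.intervene a x).solution_eq ε v).trans ?_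
      simp [intervene, hv]
    rw [singleWorld_solution_eq, e]
    congr 2
    funext u
    split_ifs with h
    · rw [h]
      refine (((M.intervene a x).solution_eq ε a).trans ?_).symm
      simp [intervene]
    · exact ih u.1 u.2 h

end SingleWorld

end SCM

/-! ### Standardization -/

section Standardization

variable {Ω E : Type*} [MeasurableSpace Ω] [MeasurableSpace E] {μ : Measure Ω}
  [IsProbabilityMeasure μ] {A Y Y' : Ω → ℝ} {W : Ω → E} {x : ℝ}

/-- If `Y` agrees with `Y'` where `A = x`, and `Y'` is conditionally independent of `A` given `W`,
then the conditional law of `Y` given `A = x` and `W` is that of `Y'` given `W`. Positivity makes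
this hold for almost all values of `W`, and not merely for those that occur with `A = x`. -/
theorem condDistrib_prod_ae_eq (hA : Measurable A) (hY : Measurable Y) (hY' : Measurable Y')
    (hW : Measurable W) (hYY' : ∀ ω, A ω = x → Y ω = Y' ω)
    (hpos : ∀ B, MeasurableSet B → μ (W ⁻¹' B) ≠ 0 → μ {ω | A ω = x ∧ W ω ∈ B} ≠ 0)
    (hci : CondIndepSigma (MeasurableSpace.comap W inferInstance)
      (MeasurableSpace.comap A inferInstance) (MeasurableSpace.comap Y' inferInstance) μ) :
    ∀ᵐ w ∂(μ.map W),
      condDistrib Y (fun ω => (A ω, W ω)) μ (x, w) = condDistrib Y' W μ w := by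
  set κ := condDistrib Y (fun ω => (A ω, W ω)) μ
  set κ' := condDistrib Y' W μ
  have hAx : MeasurableSet[MeasurableSpace.comap A inferInstance] {ω | A ω = x} :=
    ⟨{x}, measurableSet_singleton x, rfl⟩
  have key : ∀ D : Set ℝ, MeasurableSet D → ∀ᵐ w ∂(μ.map W), κ (x, w) D = κ' w D := by
    intro D hD
    have hAW : Measurable fun ω => (A ω, W ω) := hA.prodMk hW
    have hm : MeasurableSpace.comap (fun ω => (A ω, W ω)) inferInstance =
        MeasurableSpace.comap A inferInstance ⊔ MeasurableSpace.comap W inferInstance :=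
      MeasurableSpace.comap_prodMk A W
    have e1 := condDistrib_ae_eq_condExp (μ := μ) hAW hY hD
    have e2 := condDistrib_ae_eq_condExp (μ := μ) hW hY' hD
    have e3 := hci (Y' ⁻¹' D) ⟨D, hD, rfl⟩
    rw [hm] at e1
    have hAx' := (le_sup_left (a := MeasurableSpace.comap A inferInstance)
      (b := MeasurableSpace.comap W inferInstance)) _ hAx
    have i1 := condExp_indicator (μ := μ) (f := (Y ⁻¹' D).indicator (fun _ => (1 : ℝ)))
      ((integrable_const 1).indicator (hY hD)) hAx'
    have i2 := condExp_indicator (μ := μ) (f := (Y' ⁻¹' D).indicator (fun _ => (1 : ℝ)))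
      ((integrable_const 1).indicator (hY' hD)) hAx'
    -- on the event `A = x` of the conditioning σ-algebra, `Y` may be replaced by `Y'`
    have hind : {ω | A ω = x}.indicator ((Y ⁻¹' D).indicator (fun _ => (1 : ℝ))) =
        {ω | A ω = x}.indicator ((Y' ⁻¹' D).indicator (fun _ => (1 : ℝ))) := by
      refine Set.indicator_congr fun ω hω => ?_
      have h := hYY' ω hω
      by_cases hD' : Y' ω ∈ D <;> simp [h, hD']
    rw [hind] at i1
    have hae : ∀ᵐ ω ∂μ, A ω = x → κ (x, W ω) D = κ' (W ω) D := by
      filter_upwards [e1, e2, e3, i1, i2] with ω h1 h2 h3 h4 h5 hω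
      rw [h4, Set.indicator_of_mem (s := {ω | A ω = x}) hω,
        Set.indicator_of_mem (s := {ω | A ω = x}) hω] at h5
      rw [← hω]
      refine (measureReal_eq_measureReal_iff).1 ?_
      exact h1.trans (h5.trans (h3.trans h2.symm))
    have hB : MeasurableSet {w | κ (x, w) D ≠ κ' w D} :=
      (measurableSet_eq_fun ((Kernel.measurable_coe κ hD).comp measurable_prodMk_left)
        (Kernel.measurable_coe κ' hD)).compl
    rw [ae_iff, Measure.map_apply hW hB]
    -- an exceptional set of values of `W` with positive probability would, by positivity, have
    -- positive probability jointly with `A = x`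
    by_contra hne
    refine hpos _ hB hne ?_
    rw [ae_iff] at hae
    convert hae using 2
    ext ω
    simp
  have hall : ∀ᵐ w ∂(μ.map W), ∀ q : ℚ, κ (x, w) (Set.Iic (q : ℝ)) = κ' w (Set.Iic (q : ℝ)) :=
    ae_all_iff.2 fun q => key _ measurableSet_Iic
  filter_upwards [hall] with w hw
  refine ext_of_generate_finite _ (Real.borel_eq_generateFrom_Iic_rat ▸ BorelSpace.measurable_eq)
    Real.isPiSystem_Iic_rat ?_ (by simp)
  rintro _ hs
  obtain ⟨q, rfl⟩ := Set.mem_iUnion.1 hs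
  exact hw q

/-- Standardization: averaging `E[Y | A = x, W]` over the law of `W` yields the mean of `Y'`. -/
theorem integral_condDistrib_prod (hA : Measurable A) (hY : Measurable Y) (hY' : Measurable Y')
    (hW : Measurable W) (hYY' : ∀ ω, A ω = x → Y ω = Y' ω)
    (hpos : ∀ B, MeasurableSet B → μ (W ⁻¹' B) ≠ 0 → μ {ω | A ω = x ∧ W ω ∈ B} ≠ 0)
    (hci : CondIndepSigma (MeasurableSpace.comap W inferInstance)
      (MeasurableSpace.comap A inferInstance) (MeasurableSpace.comap Y' inferInstance) μ)
    (hint : Integrable Y' μ) :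
    (∀ᵐ w ∂(μ.map W), Integrable (fun y : ℝ => y) (condDistrib Y (fun ω => (A ω, W ω)) μ (x, w))) ∧
      Integrable (fun w => ∫ y, y ∂condDistrib Y (fun ω => (A ω, W ω)) μ (x, w)) (μ.map W) ∧
      ∫ w, ∫ y, y ∂condDistrib Y (fun ω => (A ω, W ω)) μ (x, w) ∂(μ.map W) = ∫ ω, Y' ω ∂μ := by
  have hae := condDistrib_prod_ae_eq hA hY hY' hW hYY' hpos hci
  have hfst : Integrable (fun p : E × ℝ => p.2) (μ.map fun ω => (W ω, Y' ω)) :=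
    (integrable_map_measure measurable_snd.aestronglyMeasurable
      (hW.prodMk hY').aemeasurable).2 hint
  have h1 : ∀ᵐ w ∂(μ.map W), Integrable (fun y : ℝ => y) (condDistrib Y' W μ w) :=
    hfst.condDistrib_ae_map hY'.aemeasurable
  have h2 : Integrable (fun w => ∫ y, y ∂condDistrib Y' W μ w) (μ.map W) :=
    hfst.integral_condDistrib_map hY'.aemeasurable
  have hcongr : (fun w => ∫ y, y ∂condDistrib Y (fun ω => (A ω, W ω)) μ (x, w)) =ᵐ[μ.map W]
      fun w => ∫ y, y ∂condDistrib Y' W μ w := by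
    filter_upwards [hae] with w hw
    rw [hw]
  refine ⟨?_, h2.congr hcongr.symm, ?_⟩
  · filter_upwards [hae, h1] with w hw hw1
    rwa [hw]
  · rw [integral_congr_ae hcongr, integral_map hW.aemeasurable h2.aestronglyMeasurable,
      ← integral_condExp (μ := μ) hW.comap_le (f := Y')]
    exact integral_congr_ae (condExp_ae_eq_integral_condDistrib' hW hint).symm

theorem condDistrib_map_measure {Ω' F : Type*} [MeasurableSpace Ω'] [MeasurableSpace F] {T : Ω → Ω'}
    (hT : Measurable T) {f : Ω' → ℝ} {g : Ω' → F} (hf : Measurable f) (hg : Measurable g)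
    [IsProbabilityMeasure (μ.map T)] :
    condDistrib f g (μ.map T) = condDistrib (f ∘ T) (g ∘ T) μ := by
  rw [condDistrib_def, condDistrib_def]
  congr 1
  exact Measure.map_map (hg.prodMk hf) hT

end Standardization

namespace SCM

variable {V U : Type*} [Fintype V] [Fintype U] {G : DAG (V ⊕ U)} (M : SCM G)

theorem obsLaw_eq_map :
    M.obsLaw = (Measure.pi M.noiseLaw).map fun ε v => M.solution ε (Sum.inl v) := by
  rw [obsLaw, law, Measure.map_map _ M.measurable_solution]
  · rfl
  · exact measurable_pi_iff.2 fun v => measurable_pi_apply _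

theorem comap_restrict_eq_varSigma (W : Finset V) [DecidableEq V] [DecidableEq U] :
    MeasurableSpace.comap (fun ε => W.restrict fun v => M.solution ε (Sum.inl v))
      (inferInstance : MeasurableSpace (W → ℝ)) =
      M.varSigma ((W.image Sum.inl : Finset (V ⊕ U)) : Set (V ⊕ U)) := by
  rw [varSigma, Finset.coe_image, iSup_image, ← iSup_subtype'']
  exact MeasurableSpace.comap_process_pi fun (w : W) ε => M.solution ε (Sum.inl w.1)

/-- Under the backdoor criterion and positivity, the regression of `Y` on `A = x` and `W`,
averaged over the law of `W`, is the mean of `Y` under `do(A = x)`. -/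
theorem regression_eq_of_backdoor [DecidableEq V] [DecidableEq U] {ord : V ⊕ U → ℕ}
    (hord : G.IsTopologicalOrder ord) {A Y : V} {W : Finset V} {x : ℝ} (hAY : A ≠ Y)
    (hbd : G.BackdoorCriterion (Sum.inl A) (Sum.inl Y) (Sum.inl '' (W : Set V)))
    (hint : Integrable (fun v : V → ℝ => v Y) (M.doLaw A x))
    (hpos : Positivity M.obsLaw A x W) :
    RegressionIntegrable M.obsLaw A Y W x ∧
      ∫ v, outcomeMean M.obsLaw A Y W x (W.restrict v) ∂M.obsLaw = ∫ v, v Y ∂(M.doLaw A x) := by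
  set μ := Measure.pi M.noiseLaw
  set T : (∀ v, M.Noise v) → V → ℝ := fun ε v => M.solution ε (Sum.inl v)
  have hT : Measurable T := measurable_pi_iff.2 fun v => M.measurable_solution_apply _
  have hP : M.obsLaw = μ.map T := M.obsLaw_eq_map
  set M' := M.singleWorld (Sum.inl A) x
  set Y' : (∀ v, M.Noise v) → ℝ := fun ε => M'.solution ε (Sum.inl Y)
  have hY' : Measurable Y' := M'.measurable_solution_apply _
  have hrestr : Measurable (W.restrict : (V → ℝ) → W → ℝ) := W.measurable_restrict
  -- the mean of `Y` under `do(A = x)` is the mean of `Y'`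
  have hdo : M.doLaw A x = μ.map fun ε v =>
      (M.intervene (Sum.inl A) x).solution ε (Sum.inl v) := obsLaw_eq_map _
  have hdoY : (fun ε => (M.intervene (Sum.inl A) x).solution ε (Sum.inl Y)) = Y' := by
    funext ε
    exact (M.singleWorld_solution_of_ne _ x ε _ fun h => hAY (Sum.inl_injective h).symm).symm
  have hTdo : Measurable fun (ε : ∀ v, M.Noise v) (v : V) =>
      (M.intervene (Sum.inl A) x).solution ε (Sum.inl v) :=
    measurable_pi_iff.2 fun v => (M.intervene (Sum.inl A) x).measurable_solution_apply _
  have hYint : Integrable Y' μ := by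
    rw [hdo] at hint
    rw [← hdoY]
    exact hint.comp_measurable hTdo
  have hdomean : ∫ v, v Y ∂(M.doLaw A x) = ∫ ε, Y' ε ∂μ := by
    rw [hdo, ← hdoY]
    exact integral_map hTdo.aemeasurable (measurable_pi_apply Y).aestronglyMeasurable
  -- conditional ignorability
  have hci : CondIndepSigma (MeasurableSpace.comap (W.restrict ∘ T) inferInstance)
      (MeasurableSpace.comap (fun ε => T ε A) inferInstance)
      (MeasurableSpace.comap Y' inferInstance) μ := by
    have hd := hbd.dSep_cutOut fun h => hAY (Sum.inl_injective h)
    rw [← Finset.coe_image] at hd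
    have hAW : Sum.inl A ∉ W.image (Sum.inl : V → V ⊕ U) := fun h => by
      obtain ⟨w, hw, hwA⟩ := Finset.mem_image.1 h
      exact hbd.1 _ ⟨w, hw, hwA⟩ .refl
    have h := M'.condIndepSigma_of_dSep (ord := ord) (fun u v huv => hord u v huv.1) hAW hd
    rw [← M'.comap_restrict_eq_varSigma W] at h
    have e1 : (fun (ε : ∀ v, M.Noise v) => M'.solution ε (Sum.inl A)) = fun ε => T ε A := by
      funext ε
      exact M.singleWorld_solution_of_not_transGen _ x ε _ (G.acyclic _)
    have e2 : (fun (ε : ∀ v, M.Noise v) => W.restrict fun v => M'.solution ε (Sum.inl v)) =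
        W.restrict ∘ T := by
      funext ε w
      exact M.singleWorld_solution_of_not_transGen _ x ε _
        fun h => hbd.1 _ ⟨w.1, w.2, rfl⟩ h.to_reflTransGen
    rw [← e1, ← e2]
    exact h
  have hpos' : ∀ B, MeasurableSet B → μ ((W.restrict ∘ T) ⁻¹' B) ≠ 0 →
      μ {ε | T ε A = x ∧ (W.restrict ∘ T) ε ∈ B} ≠ 0 := by
    intro B hB hne
    have := hpos B hB
    rw [hP, Measure.map_apply (s := {v | W.restrict v ∈ B}) hT (hrestr hB),
      Measure.map_apply hT] at this
    · exact this hne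
    · exact (measurableSet_eq_fun (measurable_pi_apply A) measurable_const).inter (hrestr hB)
  have hYY' : ∀ ε, T ε A = x → T ε Y = Y' ε := fun ε hε =>
    (M.singleWorld_solution_of_eq _ x ε hε _).symm
  have hmain := integral_condDistrib_prod (A := fun ε => T ε A) (Y := fun ε => T ε Y)
    ((measurable_pi_apply A).comp hT) ((measurable_pi_apply Y).comp hT) hY' (hrestr.comp hT) hYY'
    hpos' hci hYint
  have hlaw : ∀ w, outcomeLaw M.obsLaw A Y W x w = condDistrib (fun ε => T ε Y)
      (fun ε => (T ε A, (W.restrict ∘ T) ε)) μ (x, w) := by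
    intro w
    have : IsProbabilityMeasure (μ.map T) := hP ▸ inferInstance
    rw [outcomeLaw]
    simp only [hP]
    rw [condDistrib_map_measure hT (measurable_pi_apply Y) ((measurable_pi_apply A).prodMk hrestr)]
    rfl
  have hmap : μ.map (W.restrict ∘ T) = M.obsLaw.map W.restrict := by
    rw [hP, Measure.map_map hrestr hT]
  simp only [← hlaw, hmap] at hmain
  obtain ⟨h1, h2, h3⟩ := hmain
  refine ⟨⟨ae_of_ae_map hrestr.aemeasurable h1, h2.comp_measurable hrestr⟩, ?_⟩
  rw [hdomean, ← h3, integral_map hrestr.aemeasurable h2.aestronglyMeasurable]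
  rfl

end SCM

/-! ### The testable implication -/

theorem proposition1 {V U : Type*} [Fintype V] [Fintype U] [DecidableEq V] [DecidableEq U]
    (G : DAG (V ⊕ U)) (M : SCM G) (Z A Y : V) (C : Finset V) (hZC : Z ∉ C)
    -- the observed law is faithful to the causal DAG with latent vertices
    (hfaithful : Faithful M.obsLaw G)
    -- the causal ordering `{Z, C} < A < Y`
    (hord : ∃ ord : V ⊕ U → ℕ, G.IsTopologicalOrder ord ∧
      ord (Sum.inl Z) < ord (Sum.inl A) ∧ (∀ c ∈ C, ord (Sum.inl c) < ord (Sum.inl A)) ∧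
      ord (Sum.inl A) < ord (Sum.inl Y))
    -- the path `Z → A → Y`
    (hZA : G.edge (Sum.inl Z) (Sum.inl A)) (hAY : G.edge (Sum.inl A) (Sum.inl Y))
    -- the proposed adjustment set
    (W : Finset V) (hW : W ⊆ C)
    -- the average causal effect and the backdoor formula are well defined
    (hint : ∀ a ∈ ({0, 1} : Set ℝ), Integrable (fun v : V → ℝ => v Y) (M.doLaw A a))
    (hpos : ∀ a ∈ ({0, 1} : Set ℝ), Positivity M.obsLaw A a W)
    -- the observed data parameter that encodes the testable implication
    (β : Measure (V → ℝ) → ℝ)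
    (hβ : β M.obsLaw = 0 ↔ CI M.obsLaw {Y} {Z} (insert A W))
    (hβ0 : β M.obsLaw = 0) :
    G.BackdoorCriterion (Sum.inl A) (Sum.inl Y) (Sum.inl '' (W : Set V)) ∧
      (∀ a ∈ ({0, 1} : Set ℝ), RegressionIntegrable M.obsLaw A Y W a) ∧
      backdoorFormula M.obsLaw A Y W = M.averageCausalEffect A Y := by
  obtain ⟨ord, hord, hZA', hCA, hAY'⟩ := hord
  have hAW : ∀ w ∈ W, ord (Sum.inl w) < ord (Sum.inl A) := fun w hw => hCA w (hW hw)
  have hneAY : A ≠ Y := fun h => by simp [h] at hAY'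
  have hYZ : Disjoint ({Y} : Finset V) {Z} := Finset.disjoint_singleton.2 fun h => by
    rw [h] at hAY'
    omega
  have hYAW : Disjoint ({Y} : Finset V) (insert A W) := by
    refine Finset.disjoint_singleton_left.2 fun h => ?_
    rcases Finset.mem_insert.1 h with h | h
    · exact hneAY h.symm
    · exact (hAW _ h).not_gt hAY'
  have hZAW : Disjoint ({Z} : Finset V) (insert A W) := by
    refine Finset.disjoint_singleton_left.2 fun h => ?_
    rcases Finset.mem_insert.1 h with rfl | h
    · exact lt_irrefl _ hZA'
    · exact hZC (hW h)
  have hdsep := (hfaithful {Y} {Z} (insert A W) hYZ hYAW hZAW).2 (hβ.1 hβ0)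
  simp only [Finset.coe_singleton, Finset.coe_insert, Set.image_singleton, Set.image_insert_eq]
    at hdsep
  have hbd := hdsep.backdoorCriterion hZA <| by
    rintro _ ⟨w, hw, rfl⟩ hAw
    rcases Relation.reflTransGen_iff_eq_or_transGen.1 hAw with h | h
    · exact absurd (hAW w hw) (by rw [h]; exact lt_irrefl _)
    · exact absurd (hAW w hw) (hord.lt_of_transGen h).not_gt
  have hreg := fun a ha => M.regression_eq_of_backdoor hord hneAY hbd (hint a ha) (hpos a ha)
  have h0 := hreg 0 (by simp)
  have h1 := hreg 1 (by simp)
  refine ⟨hbd, fun a ha => (hreg a ha).1, ?_⟩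
  rw [backdoorFormula, integral_sub h1.1.2 h0.1.2, h1.2, h0.2]
  rfl
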